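/- Let $(N,g)$ be a complete smooth Riemannian manifold of dimension $3$, let $p\in N$ and $\varepsilon>0$, and let $U=\{q\in N: d_g(p,q)<\varepsilon\}$ be the geodesic ball of radius $\varepsilon$ about $p$. Then there exists a smooth complete Riemannian metric $\tilde g$ on $N$ with $\tilde g=g$ on $N\setminus U$ such that there is a smooth immersion $x:T^2=S^1\times S^1\to N$ with $W(x)=0$. Here $W$ is the Willmore functional of $x$ as an immersed surface in $(N,\tilde g)$, $$W(x)=\frac12\int_{T^2}\bigl(|II|^2-2|\vec H|^2\bigr)\,dM=\int_{T^2}\bigl(|\vec H|^2-K+\tilde K\bigr)\,dM ,$$ where $II$ is the second fundamental form of $x$, $\vec H=\frac12\operatorname{tr} II$ its mean curvature vector, $dM$ the area element and $K$ the Gauss curvature of the induced metric $x^*\tilde g$, and $\tilde K$ the sectional curvature of $(N,\tilde g)$ on the tangent planes of $x$. -/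

import Mathlib

open Set Filter MeasureTheory Manifold Bundle
open scoped Manifold ContDiff Topology ENNReal

noncomputable section

namespace Willmore

/-- A smooth Riemannian metric on the smooth `n`-manifold `N`, as a smooth section of positive
definite symmetric bilinear forms on the tangent bundle. -/
abbrev SmoothMetric (n : ℕ) (N : Type*) [TopologicalSpace N]
    [ChartedSpace (EuclideanSpace ℝ (Fin n)) N] [IsManifold (𝓡 n) ∞ N] :=
  ContMDiffRiemannianMetric (𝓡 n) ∞ (EuclideanSpace ℝ (Fin n))
    (fun q : N => TangentSpace (𝓡 n) q)

variable {n : ℕ} {N : Type*} [TopologicalSpace N]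
  [ChartedSpace (EuclideanSpace ℝ (Fin n)) N] [IsManifold (𝓡 n) ∞ N]

/-- The Riemannian distance of `g`: the infimum of the `g`-lengths of `C^1` paths from `p` to `q`
(it is `∞` if `p` and `q` lie in different components). -/
def gdist (g : SmoothMetric n N) (p q : N) : ℝ≥0∞ :=
  letI : RiemannianBundle (fun q : N => TangentSpace (𝓡 n) q) := ⟨g.toRiemannianMetric⟩
  riemannianEDist (𝓡 n) p q

/-- The open geodesic ball of radius `ε` about `p` for the metric `g`. -/
def geodesicBall (g : SmoothMetric n N) (p : N) (ε : ℝ) : Set N :=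
  {q | gdist g p q < ENNReal.ofReal ε}

/-- The metric `g` is complete: every sequence that is Cauchy for the Riemannian distance
converges. -/
def IsCompleteMetric (g : SmoothMetric n N) : Prop :=
  ∀ u : ℕ → N,
    (∀ δ : ℝ≥0∞, 0 < δ → ∃ k : ℕ, ∀ i ≥ k, ∀ j ≥ k, gdist g (u i) (u j) < δ) →
    ∃ a : N, Tendsto (fun i => gdist g (u i) a) atTop (𝓝 0)

/-! ### Levi-Civita connection in a chart

Everything below is computed in the preferred chart `extChartAt (𝓡 n) q` about a point `q`;
tangent vectors are written as their tuples of coordinates `Fin n → ℝ`. -/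

/-- The matrix `g_ab` of the metric in the chart about `q`, at the point with coordinates `y`:
the values of `g` on the coordinate vector fields of the chart. -/
def metricMatrix (g : SmoothMetric n N) (q : N) (y : EuclideanSpace ℝ (Fin n)) :
    Matrix (Fin n) (Fin n) ℝ :=
  Matrix.of fun a b =>
    g.inner ((extChartAt (𝓡 n) q).symm y)
      (mfderiv (𝓡 n) (𝓡 n) (extChartAt (𝓡 n) q).symm y (EuclideanSpace.single a (1 : ℝ)))
      (mfderiv (𝓡 n) (𝓡 n) (extChartAt (𝓡 n) q).symm y (EuclideanSpace.single b (1 : ℝ)))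

/-- The partial derivative `∂_c g_ab` in the chart about `q`, evaluated at `q`. -/
def metricPartial (g : SmoothMetric n N) (q : N) (c a b : Fin n) : ℝ :=
  fderiv ℝ (fun y => metricMatrix g q y a b) (extChartAt (𝓡 n) q q)
    (EuclideanSpace.single c (1 : ℝ))

/-- The Christoffel symbol `Γ^k_ab` of the Levi-Civita connection of `g` in the chart about `q`,
evaluated at `q`:  `Γ^k_ab = 1/2 ∑_l g^{kl} (∂_a g_bl + ∂_b g_al - ∂_l g_ab)`. -/
def christoffel (g : SmoothMetric n N) (q : N) (k a b : Fin n) : ℝ :=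
  (1 / 2) * ∑ l, (metricMatrix g q (extChartAt (𝓡 n) q q))⁻¹ k l *
    (metricPartial g q a b l + metricPartial g q b a l - metricPartial g q l a b)

/-- The inner product `g_q(v, w)` of tangent vectors at `q` given by their coordinates in the chart
about `q`. -/
def ginner (g : SmoothMetric n N) (q : N) (v w : Fin n → ℝ) : ℝ :=
  ∑ a, ∑ b, metricMatrix g q (extChartAt (𝓡 n) q q) a b * v a * w b

/-! ### Extrinsic geometry of a parametrized surface `X : ℝ² → N` -/

/-- The coordinate vector `∂_i X` at the parameter `s`, in the chart about `X s`. -/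
def tangentVec (X : (Fin 2 → ℝ) → N) (s : Fin 2 → ℝ) (i : Fin 2) : Fin n → ℝ :=
  fun k => fderiv ℝ (fun r => extChartAt (𝓡 n) (X s) (X r) k) s (Pi.single i 1)

/-- The second partial derivative `∂_i ∂_j X` at `s` of the coordinate expression of `X` in the
chart about `X s`. -/
def secondPartial (X : (Fin 2 → ℝ) → N) (s : Fin 2 → ℝ) (i j : Fin 2) : Fin n → ℝ :=
  fun k => fderiv ℝ
    (fun t => fderiv ℝ (fun r => extChartAt (𝓡 n) (X s) (X r) k) t (Pi.single j 1)) s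
    (Pi.single i 1)

/-- The covariant derivative `∇_{∂_i} ∂_j X` along `X` for the Levi-Civita connection of `g`. -/
def covDeriv (g : SmoothMetric n N) (X : (Fin 2 → ℝ) → N) (s : Fin 2 → ℝ) (i j : Fin 2) :
    Fin n → ℝ :=
  fun k => secondPartial X s i j k +
    ∑ a, ∑ b, christoffel g (X s) k a b * tangentVec X s i a * tangentVec X s j b

/-- The matrix `g(∂_i X, ∂_j X)` of the first fundamental form (induced metric). -/
def firstForm (g : SmoothMetric n N) (X : (Fin 2 → ℝ) → N) (s : Fin 2 → ℝ) :
    Matrix (Fin 2) (Fin 2) ℝ :=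
  Matrix.of fun i j => ginner g (X s) (tangentVec X s i) (tangentVec X s j)

/-- The component of `v` that is `g`-orthogonal to the tangent plane of the surface at `X s`. -/
def normalPart (g : SmoothMetric n N) (X : (Fin 2 → ℝ) → N) (s : Fin 2 → ℝ) (v : Fin n → ℝ) :
    Fin n → ℝ :=
  v - ∑ i, ∑ j, ((firstForm g X s)⁻¹ i j * ginner g (X s) v (tangentVec X s j)) •
    tangentVec X s i

/-- The (normal bundle valued) second fundamental form `II(∂_i X, ∂_j X)`. -/
def secondForm (g : SmoothMetric n N) (X : (Fin 2 → ℝ) → N) (s : Fin 2 → ℝ) (i j : Fin 2) :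
    Fin n → ℝ :=
  normalPart g X s (covDeriv g X s i j)

/-- The mean curvature vector, half the trace of the second fundamental form. -/
def meanCurvature (g : SmoothMetric n N) (X : (Fin 2 → ℝ) → N) (s : Fin 2 → ℝ) : Fin n → ℝ :=
  (1 / 2 : ℝ) • ∑ i, ∑ j, (firstForm g X s)⁻¹ i j • secondForm g X s i j

/-- The squared norm `S = |II|²` of the second fundamental form. -/
def secondFormNormSq (g : SmoothMetric n N) (X : (Fin 2 → ℝ) → N) (s : Fin 2 → ℝ) : ℝ :=
  ∑ i, ∑ j, ∑ k, ∑ l, (firstForm g X s)⁻¹ i k * (firstForm g X s)⁻¹ j l *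
    ginner g (X s) (secondForm g X s i j) (secondForm g X s k l)

/-- The Willmore integrand `1/2 (S - 2 |H|²) dM` in the coordinates of `X`, where the area element
is `dM = √(det I) ds`. -/
def willmoreDensity (g : SmoothMetric n N) (X : (Fin 2 → ℝ) → N) (s : Fin 2 → ℝ) : ℝ :=
  (1 / 2) * (secondFormNormSq g X s -
      2 * ginner g (X s) (meanCurvature g X s) (meanCurvature g X s)) *
    Real.sqrt (firstForm g X s).det

/-! ### Tori -/

/-- A smooth immersion of the torus `T² = S¹ × S¹` into `N`: a smooth map whose differential is
injective at every point. -/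
def IsImmersedTorus (n : ℕ) {N : Type*} [TopologicalSpace N]
    [ChartedSpace (EuclideanSpace ℝ (Fin n)) N] (x : Circle × Circle → N) : Prop :=
  ContMDiff ((𝓡 1).prod (𝓡 1)) (𝓡 n) ∞ x ∧
    ∀ z, Function.Injective (mfderiv ((𝓡 1).prod (𝓡 1)) (𝓡 n) x z)

/-- The torus `x` in the angular coordinates `s = (s₀, s₁)`, each taken modulo `2π`. -/
def angular (x : Circle × Circle → N) (s : Fin 2 → ℝ) : N :=
  x (Circle.exp (s 0), Circle.exp (s 1))

/-- The square `[0, 2π]²` of angles; it covers the torus once, up to a null set. -/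
def angleSquare : Set (Fin 2 → ℝ) := Icc 0 (fun _ => 2 * Real.pi)

/-- The Willmore functional `W(x) = ∫_{T²} 1/2 (S - 2 |H|²) dM = ∫_{T²} (|H|² - K + K̃) dM` of a
torus `x` in `(N, g)`. -/
def willmore (g : SmoothMetric n N) (x : Circle × Circle → N) : ℝ :=
  ∫ s in angleSquare, willmoreDensity g (angular x) s

end Willmore

end

/-!
The Willmore integrand vanishes identically as soon as the torus is totally geodesic, so it suffices
to change the metric inside the ball so that some small torus becomes totally geodesic.

The torus `x` is a small torus of revolution in a chart around `p`. Toroidal coordinates, read as a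
map `Ψ` to `ℝ⁵`, send a neighbourhood of it into `S¹ × S¹ × ℝ` and restrict on it to the standard
embedding `circles` onto `S¹ × S¹ × {1}`. Multiplying the coordinates by a cutoff `χ`, equal to `1`
near the torus, gives a map on all of `N` with compact support in the ball (`exists_local_torus`).
The new metric is `(1 - χ) g + Ψ^* ⟨ , ⟩` (`modifiedMetric`). It is positive definite: where
`χ < 1` because of the first term, and where `χ = 1` because there the cutoff is maximal, so that
`dΨ` is the differential of the toroidal coordinates, which is injective.

Near the torus the new metric is the metric induced by `Ψ`, so by the Gauss formula
(`covDeriv_eq_zero`) the covariant derivatives `∇_{∂_i} ∂_j x`, computed in any chart, are the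
components along the image of `dΨ` of the second derivatives of `Ψ ∘ x`. These second derivatives
are radial in the two circle factors (`secondDeriv_circles_exp`), hence orthogonal to
`S¹ × S¹ × ℝ` (`mvfderiv_bicircle`), and the covariant derivatives vanish.

The new metric agrees with `g` off a compact set, so the two metrics are uniformly comparable and
completeness is inherited (`IsCompleteMetric.of_eq_off_compact`).
-/

namespace Willmore

/-! ### A torus of revolution in Euclidean space -/

/-- A polynomial equation of the torus of revolution in `ℝ³` with radii `2` and `1` about the third
axis: the torus is the zero set. -/
noncomputable def torusPoly (y : EuclideanSpace ℝ (Fin 3)) : ℝ :=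
  (y 0 ^ 2 + y 1 ^ 2 + y 2 ^ 2 + 3) ^ 2 - 16 * (y 0 ^ 2 + y 1 ^ 2)

/-- The distance to the axis of the torus. -/
noncomputable def axisDist (y : EuclideanSpace ℝ (Fin 3)) : ℝ := √(y 0 ^ 2 + y 1 ^ 2)

/-- The distance to the core circle of the torus. -/
noncomputable def coreDist (y : EuclideanSpace ℝ (Fin 3)) : ℝ :=
  √((axisDist y - 2) ^ 2 + y 2 ^ 2)

/-- Toroidal coordinates: the two angles, as points of unit circles in `ℝ²`, and the distance to the
core circle. The value is meaningful off the axis and off the core circle. -/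
noncomputable def toroidal (y : EuclideanSpace ℝ (Fin 3)) : EuclideanSpace ℝ (Fin 5) :=
  !₂[y 0 / axisDist y, y 1 / axisDist y, (axisDist y - 2) / coreDist y, y 2 / coreDist y,
    coreDist y]

/-- The point with given toroidal coordinates, as a polynomial map. -/
noncomputable def toroidalInv (v : EuclideanSpace ℝ (Fin 5)) : EuclideanSpace ℝ (Fin 3) :=
  !₂[(2 + v 4 * v 2) * v 0, (2 + v 4 * v 2) * v 1, v 4 * v 3]

/-- The product `S¹ × S¹ × ℝ` in `ℝ⁵`. -/
def bicircle : Set (EuclideanSpace ℝ (Fin 5)) :=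
  {v | v 0 ^ 2 + v 1 ^ 2 = 1 ∧ v 2 ^ 2 + v 3 ^ 2 = 1}

lemma axisDist_sq (y : EuclideanSpace ℝ (Fin 3)) : axisDist y ^ 2 = y 0 ^ 2 + y 1 ^ 2 :=
  Real.sq_sqrt (by positivity)

lemma coreDist_sq (y : EuclideanSpace ℝ (Fin 3)) :
    coreDist y ^ 2 = (axisDist y - 2) ^ 2 + y 2 ^ 2 :=
  Real.sq_sqrt (by positivity)

/-- The factorization shows that `torusPoly` is at least `9` on the axis and equal to `-15` on the
core circle, so both are avoided where `|torusPoly| < 9`. -/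
lemma torusPoly_eq (y : EuclideanSpace ℝ (Fin 3)) :
    torusPoly y = (coreDist y ^ 2 - 1) * (coreDist y ^ 2 - 1 + 8 * axisDist y) := by
  rw [coreDist_sq, torusPoly, ← axisDist_sq]
  ring

lemma axisDist_pos {y : EuclideanSpace ℝ (Fin 3)} (h : torusPoly y < 9) : 0 < axisDist y := by
  refine lt_of_le_of_ne (Real.sqrt_nonneg _) fun h0 => ?_
  have h1 := axisDist_sq y
  rw [← h0] at h1
  rw [torusPoly, ← h1] at h
  nlinarith [sq_nonneg (y 2), sq_nonneg (y 0 ^ 2 + y 1 ^ 2)]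

lemma coreDist_pos {y : EuclideanSpace ℝ (Fin 3)} (h : -9 < torusPoly y) : 0 < coreDist y := by
  refine lt_of_le_of_ne (Real.sqrt_nonneg _) fun h0 => ?_
  have h1 := coreDist_sq y
  rw [← h0] at h1
  have h2 : axisDist y = 2 := by nlinarith [sq_nonneg (axisDist y - 2), sq_nonneg (y 2)]
  rw [torusPoly_eq, ← h0, h2] at h
  norm_num at h

lemma norm_lt_of_torusPoly_lt {y : EuclideanSpace ℝ (Fin 3)} (h : torusPoly y < 9) :
    ‖y‖ < 4 := by
  have h1 : ‖y‖ ^ 2 = y 0 ^ 2 + y 1 ^ 2 + y 2 ^ 2 := by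
    rw [EuclideanSpace.norm_sq_eq]
    simp [Fin.sum_univ_three]
  rw [torusPoly] at h
  have h2 : ‖y‖ ^ 2 < 16 := by
    rw [h1]
    nlinarith [sq_nonneg (y 2), sq_nonneg (y 0 ^ 2 + y 1 ^ 2 + y 2 ^ 2)]
  nlinarith [norm_nonneg y]

lemma toroidalInv_toroidal {y : EuclideanSpace ℝ (Fin 3)} (h : |torusPoly y| < 9) :
    toroidalInv (toroidal y) = y := by
  have h1 := (axisDist_pos (abs_lt.1 h).2).ne'
  have h2 := (coreDist_pos (abs_lt.1 h).1).ne'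
  ext i
  fin_cases i <;> simp [toroidalInv, toroidal] <;> field_simp <;> ring

lemma toroidal_mem_bicircle {y : EuclideanSpace ℝ (Fin 3)} (h : |torusPoly y| < 9) :
    toroidal y ∈ bicircle := by
  have h1 := (axisDist_pos (abs_lt.1 h).2).ne'
  have h2 := (coreDist_pos (abs_lt.1 h).1).ne'
  constructor
  · simp [toroidal]
    field_simp
    exact (axisDist_sq y).symm
  · simp [toroidal]
    field_simp
    exact (coreDist_sq y).symm

lemma axisDist_toroidalInv {v : EuclideanSpace ℝ (Fin 5)} (hv : v ∈ bicircle) (h4 : v 4 = 1) :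
    axisDist (toroidalInv v) = 2 + v 2 := by
  obtain ⟨h1, h2⟩ := hv
  have : (0 : ℝ) ≤ 2 + v 2 := by nlinarith [sq_nonneg (v 3)]
  rw [axisDist, ← Real.sqrt_sq this]
  congr 1
  simp [toroidalInv, h4]
  linear_combination (2 + v 2) ^ 2 * h1

lemma coreDist_toroidalInv {v : EuclideanSpace ℝ (Fin 5)} (hv : v ∈ bicircle) (h4 : v 4 = 1) :
    coreDist (toroidalInv v) = 1 := by
  rw [coreDist, axisDist_toroidalInv hv h4, Real.sqrt_eq_one]
  simp [toroidalInv, h4]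
  exact hv.2

lemma torusPoly_toroidalInv {v : EuclideanSpace ℝ (Fin 5)} (hv : v ∈ bicircle) (h4 : v 4 = 1) :
    torusPoly (toroidalInv v) = 0 := by
  rw [torusPoly_eq, coreDist_toroidalInv hv h4]
  ring

lemma toroidal_toroidalInv {v : EuclideanSpace ℝ (Fin 5)} (hv : v ∈ bicircle) (h4 : v 4 = 1) :
    toroidal (toroidalInv v) = v := by
  have : (2 + v 2 : ℝ) ≠ 0 := by
    have := hv.2
    nlinarith [sq_nonneg (v 3)]
  ext i
  fin_cases i <;>
    simp [toroidal, axisDist_toroidalInv hv h4, coreDist_toroidalInv hv h4, h4] <;>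
    simp [toroidalInv, h4] <;> field_simp

lemma contDiff_torusPoly : ContDiff ℝ ∞ torusPoly := by
  unfold torusPoly
  fun_prop

lemma contDiff_toroidalInv : ContDiff ℝ ∞ toroidalInv := by
  rw [contDiff_euclidean]
  intro i
  fin_cases i <;> simp [toroidalInv] <;> fun_prop

lemma contDiffAt_toroidal {y : EuclideanSpace ℝ (Fin 3)} (h : |torusPoly y| < 9) :
    ContDiffAt ℝ ∞ toroidal y := by
  have h1 := (axisDist_pos (abs_lt.1 h).2).ne'
  have h2 := (coreDist_pos (abs_lt.1 h).1).ne'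
  have h3 : ContDiffAt ℝ ∞ axisDist y := by
    refine ContDiffAt.sqrt (by fun_prop) ?_
    rw [← axisDist_sq]
    positivity
  have h4 : ContDiffAt ℝ ∞ coreDist y := by
    refine ContDiffAt.sqrt (by fun_prop) ?_
    rw [← coreDist_sq]
    positivity
  have hc : ∀ i, ContDiffAt ℝ ∞ (fun y : EuclideanSpace ℝ (Fin 3) => y i) y := fun i => by fun_prop
  rw [contDiffAt_euclidean]
  intro i
  fin_cases i <;> simp [toroidal]
  · exact (hc 0).div h3 h1
  · exact (hc 1).div h3 h1
  · exact (h3.sub contDiffAt_const).div h4 h2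
  · exact (hc 2).div h4 h2
  · exact h4

/-- A bump function on `ℝ` whose composition with `torusPoly` cuts off around the torus. -/
noncomputable def levelBump : ContDiffBump (0 : ℝ) := ⟨1, 2, one_pos, one_lt_two⟩

/-- A smooth cutoff function, equal to `1` near the torus and vanishing away from it. -/
noncomputable def torusCutoff (y : EuclideanSpace ℝ (Fin 3)) : ℝ := levelBump (torusPoly y)

/-- Toroidal coordinates, cut off so as to be globally smooth. -/
noncomputable def cutToroidal (y : EuclideanSpace ℝ (Fin 3)) : EuclideanSpace ℝ (Fin 5) :=
  torusCutoff y • toroidal y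

lemma abs_torusPoly_lt {y : EuclideanSpace ℝ (Fin 3)} (h : torusCutoff y ≠ 0) :
    |torusPoly y| < 2 := by
  have : torusPoly y ∈ Function.support levelBump := h
  rw [levelBump.support_eq] at this
  simpa [levelBump] using this

lemma norm_lt_of_torusCutoff_ne_zero {y : EuclideanSpace ℝ (Fin 3)} (h : torusCutoff y ≠ 0) :
    ‖y‖ < 4 :=
  norm_lt_of_torusPoly_lt (by linarith [(abs_lt.1 (abs_torusPoly_lt h)).2])

lemma torusCutoff_nonneg (y : EuclideanSpace ℝ (Fin 3)) : 0 ≤ torusCutoff y := levelBump.nonneg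

lemma torusCutoff_le_one (y : EuclideanSpace ℝ (Fin 3)) : torusCutoff y ≤ 1 := levelBump.le_one

lemma contDiff_torusCutoff : ContDiff ℝ ∞ torusCutoff := levelBump.contDiff.comp contDiff_torusPoly

lemma contDiff_cutToroidal : ContDiff ℝ ∞ cutToroidal := by
  rw [contDiff_iff_contDiffAt]
  intro y
  rcases lt_or_ge |torusPoly y| 9 with h | h
  · exact contDiff_torusCutoff.contDiffAt.smul (contDiffAt_toroidal h)
  · have : cutToroidal =ᶠ[𝓝 y] fun _ => 0 := by
      have hc : ContinuousAt (fun y => |torusPoly y|) y :=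
        contDiff_torusPoly.continuous.abs.continuousAt
      filter_upwards [hc.eventually_const_lt (lt_of_lt_of_le (by norm_num : (2 : ℝ) < 9) h)]
        with z hz
      have : torusCutoff z = 0 := by
        by_contra h0
        exact absurd (abs_torusPoly_lt h0) hz.not_gt
      simp [cutToroidal, this]
    exact contDiffAt_const.congr_of_eventuallyEq this

/-- Where the cutoff is `1` it is maximal, so its derivative vanishes and the derivative of the
cut-off coordinates is that of the coordinates. -/
lemma fderiv_cutToroidal_injective {y : EuclideanSpace ℝ (Fin 3)} (h : torusCutoff y = 1) :
    Function.Injective (fderiv ℝ cutToroidal y) := by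
  have hQ : |torusPoly y| < 9 := (abs_torusPoly_lt (by simp [h])).trans (by norm_num)
  have hmax : fderiv ℝ torusCutoff y = 0 :=
    IsLocalMax.fderiv_eq_zero (Eventually.of_forall fun z => by
      rw [h]; exact torusCutoff_le_one z)
  have ht := (contDiffAt_toroidal hQ).differentiableAt (by simp)
  have h1 : fderiv ℝ cutToroidal y = fderiv ℝ toroidal y := by
    unfold cutToroidal
    rw [fderiv_fun_smul (contDiff_torusCutoff.differentiable (by simp) y) ht, hmax, h]
    ext v
    simp
  have h2 : (toroidalInv ∘ toroidal) =ᶠ[𝓝 y] id := by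
    have hc : ContinuousAt (fun y => |torusPoly y|) y :=
      contDiff_torusPoly.continuous.abs.continuousAt
    filter_upwards [hc.eventually_lt_const hQ] with z hz using toroidalInv_toroidal hz
  have h3 := h2.fderiv_eq (𝕜 := ℝ)
  rw [fderiv_comp _ (contDiff_toroidalInv.differentiable (by simp) _) ht, fderiv_id] at h3
  rw [h1]
  intro v w hvw
  have := congrArg (fderiv ℝ toroidalInv (toroidal y)) hvw
  simpa [← ContinuousLinearMap.comp_apply, h3] using this

/-- The standard embedding of `T² = S¹ × S¹` in `ℝ⁵`, as `S¹ × S¹ × {1}`. -/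
noncomputable def circles (z : Circle × Circle) : EuclideanSpace ℝ (Fin 5) :=
  !₂[(z.1 : ℂ).re, (z.1 : ℂ).im, (z.2 : ℂ).re, (z.2 : ℂ).im, 1]

lemma circles_mem_bicircle (z : Circle × Circle) : circles z ∈ bicircle := by
  have h : ∀ w : Circle, (w : ℂ).re ^ 2 + (w : ℂ).im ^ 2 = 1 := fun w => by
    have := Circle.normSq_coe w
    rw [Complex.normSq_apply] at this
    linarith
  exact ⟨by simpa [circles] using h z.1, by simpa [circles] using h z.2⟩

lemma torusPoly_circles (z : Circle × Circle) : torusPoly (toroidalInv (circles z)) = 0 :=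
  torusPoly_toroidalInv (circles_mem_bicircle z) (by simp [circles])

lemma eventually_torusCutoff_eq_one (z : Circle × Circle) :
    ∀ᶠ y in 𝓝 (toroidalInv (circles z)), torusCutoff y = 1 ∧ cutToroidal y ∈ bicircle := by
  have hc : ContinuousAt (fun y => |torusPoly y|) (toroidalInv (circles z)) :=
    contDiff_torusPoly.continuous.abs.continuousAt
  have h0 : |torusPoly (toroidalInv (circles z))| < 1 := by
    rw [torusPoly_circles]
    norm_num
  filter_upwards [hc.eventually_lt_const h0] with y hy
  have h1 : torusCutoff y = 1 :=
    levelBump.one_of_mem_closedBall (by simpa [levelBump] using hy.le)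
  refine ⟨h1, ?_⟩
  rw [cutToroidal, h1, one_smul]
  exact toroidal_mem_bicircle (hy.trans (by norm_num))

lemma cutToroidal_circles (z : Circle × Circle) :
    cutToroidal (toroidalInv (circles z)) = circles z := by
  rw [cutToroidal, (eventually_torusCutoff_eq_one z).self_of_nhds.1, one_smul,
    toroidal_toroidalInv (circles_mem_bicircle z) (by simp [circles])]

attribute [local instance] finrank_real_complex_fact'

lemma contMDiff_circles :
    ContMDiff ((𝓡 1).prod (𝓡 1)) 𝓘(ℝ, EuclideanSpace ℝ (Fin 5)) ∞ circles := by
  let A : ℂ × ℂ → EuclideanSpace ℝ (Fin 5) := fun z => !₂[z.1.re, z.1.im, z.2.re, z.2.im, 1]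
  have hA : ContDiff ℝ ∞ A := by
    rw [contDiff_euclidean]
    have hr : ContDiff ℝ ∞ Complex.re := Complex.reCLM.contDiff
    have hi : ContDiff ℝ ∞ Complex.im := Complex.imCLM.contDiff
    intro i
    fin_cases i <;> simp [A] <;> fun_prop
  have h1 : ContMDiff (𝓡 1) 𝓘(ℝ, ℂ) ∞ (fun z : Circle => (z : ℂ)) := contMDiff_coe_sphere
  exact hA.contMDiff.comp ((h1.comp contMDiff_fst).prodMk_space (h1.comp contMDiff_snd))

/-- The standard embedding of the torus is an immersion. -/
lemma mfderiv_circles_injective (z : Circle × Circle) :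
    Function.Injective
      (mfderiv ((𝓡 1).prod (𝓡 1)) 𝓘(ℝ, EuclideanSpace ℝ (Fin 5)) circles z) := by
  let B : Fin 5 → Fin 5 → EuclideanSpace ℝ (Fin 5) → ℂ :=
    fun i j v => Complex.equivRealProdCLM.symm (v i, v j)
  have hB : ∀ i j, ContDiff ℝ ∞ (B i j) := fun i j =>
    Complex.equivRealProdCLM.symm.contDiff.comp (by fun_prop)
  have hBd : ∀ i j x, MDifferentiableAt 𝓘(ℝ, EuclideanSpace ℝ (Fin 5)) 𝓘(ℝ, ℂ) (B i j) x :=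
    fun i j x => (hB i j).contMDiff.mdifferentiable (by simp) x
  have hcd := contMDiff_circles.mdifferentiable (by simp) z
  have hc : MDifferentiable (𝓡 1) 𝓘(ℝ, ℂ) (fun z : Circle => (z : ℂ)) :=
    (contMDiff_coe_sphere (m := ∞)).mdifferentiable (by simp)
  have hci : ∀ w : Circle,
      Function.Injective (mfderiv (𝓡 1) 𝓘(ℝ, ℂ) (fun z : Circle => (z : ℂ)) w) := by
    intro w
    exact injective_mvfderiv_subtypeVal_sphere (E := ℂ) w
  have e1 : B 0 1 ∘ circles = (fun z : Circle => (z : ℂ)) ∘ Prod.fst := by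
    funext w
    apply Complex.ext <;> simp [B, circles]
  have e2 : B 2 3 ∘ circles = (fun z : Circle => (z : ℂ)) ∘ Prod.snd := by
    funext w
    apply Complex.ext <;> simp [B, circles]
  have d1 := (hBd 0 1 _).hasMFDerivAt.comp z hcd.hasMFDerivAt
  have d2 := (hBd 2 3 _).hasMFDerivAt.comp z hcd.hasMFDerivAt
  rw [e1] at d1
  rw [e2] at d2
  replace d1 := hasMFDerivAt_unique d1 ((hc _).hasMFDerivAt.comp z (hasMFDerivAt_fst z))
  replace d2 := hasMFDerivAt_unique d2 ((hc _).hasMFDerivAt.comp z (hasMFDerivAt_snd z))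
  intro v w hvw
  refine Prod.ext (hci z.1 ?_) (hci z.2 ?_)
  · refine (congrArg (fun L => L v) d1).symm.trans (Eq.trans ?_ (congrArg (fun L => L w) d1))
    exact congrArg (mfderiv 𝓘(ℝ, EuclideanSpace ℝ (Fin 5)) 𝓘(ℝ, ℂ) (B 0 1) (circles z)) hvw
  · refine (congrArg (fun L => L v) d2).symm.trans (Eq.trans ?_ (congrArg (fun L => L w) d2))
    exact congrArg (mfderiv 𝓘(ℝ, EuclideanSpace ℝ (Fin 5)) 𝓘(ℝ, ℂ) (B 2 3) (circles z)) hvw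

/-! ### Transplanting the torus to a manifold -/

/-- Every point of a `3`-manifold has arbitrarily small neighbourhoods containing a torus `x`, along
with a map `Ψ` to `ℝ⁵` that near the torus takes values in `S¹ × S¹ × ℝ` and restricts on the torus
to its standard embedding, and a cutoff `χ` such that `Ψ` is an immersion where `χ = 1`. -/
lemma exists_local_torus {N : Type*} [TopologicalSpace N] [T2Space N]
    [ChartedSpace (EuclideanSpace ℝ (Fin 3)) N] [IsManifold (𝓡 3) ∞ N] (p : N) {U : Set N}
    (hU : U ∈ 𝓝 p) :
    ∃ (K : Set N) (χ : N → ℝ) (Ψ : N → EuclideanSpace ℝ (Fin 5)) (x : Circle × Circle → N),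
      IsCompact K ∧ K ⊆ U ∧ ContMDiff (𝓡 3) 𝓘(ℝ) ∞ χ ∧
      ContMDiff (𝓡 3) 𝓘(ℝ, EuclideanSpace ℝ (Fin 5)) ∞ Ψ ∧
      (∀ q, 0 ≤ χ q ∧ χ q ≤ 1) ∧
      (∀ q ∉ K, χ q = 0 ∧ Ψ =ᶠ[𝓝 q] fun _ => 0) ∧
      (∀ q, χ q = 1 → Function.Injective (mvfderiv (𝓡 3) Ψ q)) ∧
      ContMDiff ((𝓡 1).prod (𝓡 1)) (𝓡 3) ∞ x ∧
      (∀ z, Ψ (x z) = circles z) ∧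
      ∀ z, ∀ᶠ q in 𝓝 (x z), χ q = 1 ∧ Ψ q ∈ bicircle := by
  obtain ⟨f, -, hf⟩ := (SmoothBumpFunction.nhds_basis_tsupport (I := 𝓡 3) p).mem_iff.1 hU
  -- The cutoff `torusCutoff` is supported in the ball of radius `4`, which has to fit into the
  -- inner ball of `f`.
  set δ : ℝ := f.rIn / 4 with hδ
  have hδ0 : 0 < δ := by have := f.rIn_pos; positivity
  set c := extChartAt (𝓡 3) p p with hc
  let a : EuclideanSpace ℝ (Fin 3) → EuclideanSpace ℝ (Fin 3) := fun y => δ⁻¹ • (y - c)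
  have ha : ContDiff ℝ ∞ a := by fun_prop
  let A : N → EuclideanSpace ℝ (Fin 3) := a ∘ extChartAt (𝓡 3) p
  have hA : ContMDiffOn (𝓡 3) 𝓘(ℝ, EuclideanSpace ℝ (Fin 3)) ∞ A
      (chartAt (EuclideanSpace ℝ (Fin 3)) p).source :=
    ha.contMDiff.comp_contMDiffOn contMDiffOn_extChartAt
  -- Within the inner radius of the bump function it is `1`, so it plays no role there.
  have hnear : ∀ q ∈ (chartAt (EuclideanSpace ℝ (Fin 3)) p).source, ‖A q‖ < 4 → f =ᶠ[𝓝 q] 1 := by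
    intro q hq hAq
    refine f.eventuallyEq_one_of_dist_lt hq ?_
    simp only [A, a, Function.comp, norm_smul, norm_inv, Real.norm_eq_abs, abs_of_pos hδ0] at hAq
    rw [dist_eq_norm]
    change ‖extChartAt (𝓡 3) p q - c‖ < f.rIn
    rw [inv_mul_lt_iff₀ hδ0] at hAq
    linarith
  have htgt : ∀ y : EuclideanSpace ℝ (Fin 3), ‖y‖ < 4 →
      c + δ • y ∈ (extChartAt (𝓡 3) p).target := by
    intro y hy
    apply f.ball_subset
    refine ⟨?_, by simp⟩
    rw [Metric.mem_ball, dist_eq_norm]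
    change ‖c + δ • y - c‖ < f.rOut
    rw [add_sub_cancel_left, norm_smul, Real.norm_eq_abs,
      abs_of_pos hδ0]
    have := f.rIn_lt_rOut
    nlinarith
  have hX4 : ∀ z, ‖toroidalInv (circles z)‖ < 4 := fun z =>
    norm_lt_of_torusPoly_lt (by rw [torusPoly_circles]; norm_num)
  set x : Circle × Circle → N := fun z =>
    (extChartAt (𝓡 3) p).symm (c + δ • toroidalInv (circles z)) with hx
  have hxs : ∀ z, x z ∈ (chartAt (EuclideanSpace ℝ (Fin 3)) p).source := fun z => by
    rw [← extChartAt_source (𝓡 3)]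
    exact (extChartAt (𝓡 3) p).map_target (htgt _ (hX4 z))
  have hAx : ∀ z, A (x z) = toroidalInv (circles z) := fun z => by
    simp only [A, a, Function.comp, hx]
    rw [(extChartAt (𝓡 3) p).right_inv (htgt _ (hX4 z)), add_sub_cancel_left,
      inv_smul_smul₀ hδ0.ne']
  have hnorm : ∀ q, f q * torusCutoff (A q) = 1 →
      q ∈ (chartAt (EuclideanSpace ℝ (Fin 3)) p).source ∧ torusCutoff (A q) = 1 ∧ f =ᶠ[𝓝 q] 1 := by
    intro q hq
    have hf1 := f.le_one (x := q)
    have hf0 := f.nonneg (x := q)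
    have ht1 := torusCutoff_le_one (A q)
    have ht0 := torusCutoff_nonneg (A q)
    have h1 : torusCutoff (A q) = 1 := by nlinarith
    have hs : q ∈ (chartAt (EuclideanSpace ℝ (Fin 3)) p).source := by
      apply f.support_subset_source
      intro h0
      rw [h0] at hq
      simp at hq
    exact ⟨hs, h1, hnear q hs (norm_lt_of_torusCutoff_ne_zero (by simp [h1]))⟩
  refine ⟨tsupport f, fun q => f q • torusCutoff (A q), fun q => f q • cutToroidal (A q), x,
    f.hasCompactSupport, hf, ?_, ?_, ?_, ?_, ?_, ?_, ?_, ?_⟩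
  · exact f.contMDiff_smul (contDiff_torusCutoff.contMDiff.comp_contMDiffOn hA)
  · exact f.contMDiff_smul (contDiff_cutToroidal.contMDiff.comp_contMDiffOn hA)
  · intro q
    exact ⟨mul_nonneg f.nonneg (torusCutoff_nonneg _),
      mul_le_one₀ f.le_one (torusCutoff_nonneg _) (torusCutoff_le_one _)⟩
  · intro q hq
    have h := notMem_tsupport_iff_eventuallyEq.1 hq
    refine ⟨by simp [h.self_of_nhds], ?_⟩
    filter_upwards [h] with r hr
    simp [hr]
  · intro q hq
    obtain ⟨hs, h1, h2⟩ := hnorm q hq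
    have h3 : (fun q => f q • cutToroidal (A q)) =ᶠ[𝓝 q]
        (cutToroidal ∘ a) ∘ extChartAt (𝓡 3) p := by
      filter_upwards [h2] with r hr
      simp [hr, A]
    have hs' : q ∈ (extChartAt (𝓡 3) p).source := by rwa [extChartAt_source]
    have hd : MDifferentiableAt (𝓡 3) 𝓘(ℝ, EuclideanSpace ℝ (Fin 3)) (extChartAt (𝓡 3) p) q :=
      mdifferentiableAt_extChartAt hs
    have hda : ∀ y, HasFDerivAt a (δ⁻¹ • ContinuousLinearMap.id ℝ _) y := fun y =>
      ((hasFDerivAt_id y).sub_const c).const_smul δ⁻¹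
    have hdc : ContDiff ℝ ∞ (cutToroidal ∘ a) := contDiff_cutToroidal.comp ha
    have e : mvfderiv (𝓡 3) (fun q => f q • cutToroidal (A q)) q =
        (fderiv ℝ cutToroidal (A q) ∘L (δ⁻¹ • ContinuousLinearMap.id ℝ _)) ∘L
          mfderiv (𝓡 3) 𝓘(ℝ, EuclideanSpace ℝ (Fin 3)) (extChartAt (𝓡 3) p) q := by
      have h4 : HasMFDerivAt (𝓡 3) 𝓘(ℝ, EuclideanSpace ℝ (Fin 5))
          (fun q => f q • cutToroidal (A q)) q
          ((fderiv ℝ cutToroidal (A q) ∘L (δ⁻¹ • ContinuousLinearMap.id ℝ _)) ∘L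
          mfderiv (𝓡 3) 𝓘(ℝ, EuclideanSpace ℝ (Fin 3)) (extChartAt (𝓡 3) p) q) := by
        refine HasMFDerivAt.congr_of_eventuallyEq ?_ h3
        refine HasMFDerivAt.comp q ?_ hd.hasMFDerivAt
        refine HasFDerivAt.hasMFDerivAt ?_
        exact ((contDiff_cutToroidal.differentiable (by simp) _).hasFDerivAt).comp _ (hda _)
      rw [mvfderiv, h4.mfderiv]
      rfl
    rw [e]
    intro v w hvw
    have h5 := fderiv_cutToroidal_injective h1 hvw
    have h6 : mfderiv (𝓡 3) 𝓘(ℝ, EuclideanSpace ℝ (Fin 3)) (extChartAt (𝓡 3) p) q v =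
        mfderiv (𝓡 3) 𝓘(ℝ, EuclideanSpace ℝ (Fin 3)) (extChartAt (𝓡 3) p) q w :=
      smul_right_injective (EuclideanSpace ℝ (Fin 3)) (inv_ne_zero hδ0.ne') h5
    exact (isInvertible_mfderiv_extChartAt hs').injective h6
  · have h : ContDiff ℝ ∞ fun v => c + δ • toroidalInv v := by
      have := contDiff_toroidalInv
      fun_prop
    exact (contMDiffOn_extChartAt_symm p).comp_contMDiff (h.contMDiff.comp contMDiff_circles)
      fun z => htgt _ (hX4 z)
  · intro z
    have h := hnear _ (hxs z) (by rw [hAx]; exact hX4 z)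
    simp only
    rw [h.self_of_nhds, hAx, cutToroidal_circles]
    simp
  · intro z
    have h := hnear _ (hxs z) (by rw [hAx]; exact hX4 z)
    have hAc : ContinuousAt A (x z) := (hA.contMDiffAt
      ((chartAt (EuclideanSpace ℝ (Fin 3)) p).open_source.mem_nhds (hxs z))).continuousAt
    have h' := eventually_torusCutoff_eq_one z
    rw [← hAx] at h'
    filter_upwards [h, hAc.eventually h'] with q hq hq'
    simpa [hq] using hq'

/-! ### Modifying a Riemannian metric by an induced metric -/

section Metric

variable {n : ℕ} {N : Type*} [TopologicalSpace N]
  [ChartedSpace (EuclideanSpace ℝ (Fin n)) N] [IsManifold (𝓡 n) ∞ N]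
  {V : Type*} [NormedAddCommGroup V] [InnerProductSpace ℝ V]

/-- The symmetric bilinear form induced on the tangent spaces by a map to an inner product space. -/
noncomputable def inducedForm (Ψ : N → V) (q : N) :
    TangentSpace (𝓡 n) q →L[ℝ] TangentSpace (𝓡 n) q →L[ℝ] ℝ :=
  (mvfderiv (𝓡 n) Ψ q).precomp ℝ ∘L (innerSL ℝ : V →L[ℝ] V →L[ℝ] ℝ) ∘L mvfderiv (𝓡 n) Ψ q

omit [IsManifold (𝓡 n) ∞ N] in
lemma inducedForm_apply (Ψ : N → V) (q : N) (v w : TangentSpace (𝓡 n) q) :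
    inducedForm Ψ q v w = inner ℝ (mvfderiv (𝓡 n) Ψ q v) (mvfderiv (𝓡 n) Ψ q w) := rfl

lemma contMDiff_inducedForm {Ψ : N → V} (hΨ : ContMDiff (𝓡 n) 𝓘(ℝ, V) ∞ Ψ) :
    ContMDiff (𝓡 n) ((𝓡 n).prod 𝓘(ℝ, EuclideanSpace ℝ (Fin n) →L[ℝ]
        EuclideanSpace ℝ (Fin n) →L[ℝ] ℝ)) ∞
      (fun q : N => TotalSpace.mk' (EuclideanSpace ℝ (Fin n) →L[ℝ]
        EuclideanSpace ℝ (Fin n) →L[ℝ] ℝ)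
        (E := fun q : N => TangentSpace (𝓡 n) q →L[ℝ] TangentSpace (𝓡 n) q →L[ℝ] ℝ)
        q (inducedForm Ψ q)) := by
  intro x
  rw [contMDiffAt_hom_bundle]
  refine ⟨contMDiffAt_id, ?_⟩
  have h1 : ContMDiffAt (𝓡 n) 𝓘(ℝ, EuclideanSpace ℝ (Fin n) →L[ℝ] V) ∞
      (inTangentCoordinates (𝓡 n) 𝓘(ℝ, V) id Ψ (fun q => mfderiv (𝓡 n) 𝓘(ℝ, V) Ψ q) x) x :=
    (hΨ x).mfderiv_const (by simp)
  set D := inTangentCoordinates (𝓡 n) 𝓘(ℝ, V) id Ψ (fun q => mfderiv (𝓡 n) 𝓘(ℝ, V) Ψ q) x with hD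
  have h2 : ContMDiffAt (𝓡 n) 𝓘(ℝ, EuclideanSpace ℝ (Fin n) →L[ℝ]
        EuclideanSpace ℝ (Fin n) →L[ℝ] ℝ) ∞
      (fun q => (ContinuousLinearMap.compL ℝ (EuclideanSpace ℝ (Fin n)) V ℝ).flip (D q) ∘L
        (innerSL ℝ : V →L[ℝ] V →L[ℝ] ℝ) ∘L D q) x := by
    have h3 : ContDiff ℝ ∞ (fun T : EuclideanSpace ℝ (Fin n) →L[ℝ] V =>
        (ContinuousLinearMap.compL ℝ (EuclideanSpace ℝ (Fin n)) V ℝ).flip T ∘L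
          (innerSL ℝ : V →L[ℝ] V →L[ℝ] ℝ) ∘L T) := by
      fun_prop
    exact h3.contMDiff.contMDiffAt.comp x h1
  refine h2.congr_of_eventuallyEq ?_
  filter_upwards [(trivializationAt (EuclideanSpace ℝ (Fin n))
    (fun q : N => TangentSpace (𝓡 n) q) x).open_baseSet.mem_nhds
      (FiberBundle.mem_baseSet_trivializationAt' x)] with q hq
  ext v w
  rw [inCoordinates_apply_eq₂ hq hq (mem_univ _)]
  have key : ∀ u, D q u = mvfderiv (𝓡 n) Ψ q ((trivializationAt (EuclideanSpace ℝ (Fin n))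
      (fun q : N => TangentSpace (𝓡 n) q) x).symm q u) := by
    intro u
    simp only [hD, inTangentCoordinates, ContinuousLinearMap.inCoordinates, mvfderiv, id]
    rw [TangentBundle.continuousLinearMapAt_model_space]
    rw [← Trivialization.symmL_apply (R := ℝ)]
    · rfl
    · exact hq
  change _ = inner ℝ (D q v) (D q w)
  rw [key, key]
  simp [inducedForm_apply]

/-- A positive definite form on a finite-dimensional space has bounded unit ball. -/
lemma isVonNBounded_of_pos {E : Type*} [NormedAddCommGroup E] [NormedSpace ℝ E]
    [FiniteDimensional ℝ E] (B : E →L[ℝ] E →L[ℝ] ℝ) (hB : ∀ v, v ≠ 0 → 0 < B v v) :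
    Bornology.IsVonNBounded ℝ {v | B v v < 1} := by
  rw [NormedSpace.isVonNBounded_iff]
  rcases (Metric.sphere (0 : E) 1).eq_empty_or_nonempty with h | h
  · have : Subsingleton E := by
      by_contra hn
      rw [not_subsingleton_iff_nontrivial] at hn
      exact (NormedSpace.sphere_nonempty.2 zero_le_one).ne_empty h
    exact (Set.toFinite _).isBounded
  · have hc : Continuous fun v => B v v := by fun_prop
    obtain ⟨v₀, hv₀, hmin⟩ := (isCompact_sphere (0 : E) 1).exists_isMinOn h hc.continuousOn
    have h0 : 0 < B v₀ v₀ := hB v₀ (by rintro rfl; simp at hv₀)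
    refine (Metric.isBounded_closedBall (x := (0 : E)) (r := √(1 / B v₀ v₀))).subset fun v hv => ?_
    rw [mem_closedBall_zero_iff]
    apply Real.le_sqrt_of_sq_le
    rcases eq_or_ne v 0 with rfl | hv0
    · simp [h0.le]
    have h1 : B v₀ v₀ ≤ B (‖v‖⁻¹ • v) (‖v‖⁻¹ • v) :=
      hmin (by simp [norm_smul, inv_mul_cancel₀ (norm_ne_zero_iff.2 hv0)])
    have h2 : B (‖v‖⁻¹ • v) (‖v‖⁻¹ • v) = (‖v‖ ^ 2)⁻¹ * B v v := by
      simp only [map_smul, smul_apply, smul_eq_mul]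
      ring
    have h3 : 0 < ‖v‖ ^ 2 := by positivity
    rw [h2, le_inv_mul_iff₀ h3] at h1
    rw [le_div_iff₀ h0]
    exact h1.trans hv.le

/-- The symmetric bilinear form `(1 - χ) g + Ψ^* ⟨ , ⟩`. -/
noncomputable def modifiedForm (g : SmoothMetric n N) (χ : N → ℝ) (Ψ : N → V) (q : N) :
    TangentSpace (𝓡 n) q →L[ℝ] TangentSpace (𝓡 n) q →L[ℝ] ℝ :=
  (1 - χ q) • g.inner q + inducedForm (n := n) Ψ q

lemma modifiedForm_apply (g : SmoothMetric n N) (χ : N → ℝ) (Ψ : N → V) (q : N)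
    (v w : TangentSpace (𝓡 n) q) :
    modifiedForm g χ Ψ q v w = (1 - χ q) * g.inner q v w +
      inner ℝ (mvfderiv (𝓡 n) Ψ q v) (mvfderiv (𝓡 n) Ψ q w) := rfl

lemma modifiedForm_pos (g : SmoothMetric n N) {χ : N → ℝ} {Ψ : N → V} {q : N} (hχ1 : χ q ≤ 1)
    (hinj : χ q = 1 → Function.Injective (mvfderiv (𝓡 n) Ψ q)) (v : TangentSpace (𝓡 n) q)
    (hv : v ≠ 0) : 0 < modifiedForm g χ Ψ q v v := by
  rw [modifiedForm_apply]
  have h1 := g.pos q v hv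
  rcases hχ1.lt_or_eq with h | h
  · exact add_pos_of_pos_of_nonneg (mul_pos (by linarith) h1) real_inner_self_nonneg
  · rw [h, sub_self, zero_mul, zero_add, real_inner_self_pos]
    exact fun h0 => hv (hinj h (by rw [h0, map_zero]))

/-- The metric `(1 - χ) g + Ψ^* ⟨ , ⟩`, for a cutoff `χ` such that `Ψ` is an immersion where
`χ = 1`. -/
noncomputable def modifiedMetric (g : SmoothMetric n N) (χ : N → ℝ) (Ψ : N → V)
    (hχ : ContMDiff (𝓡 n) 𝓘(ℝ) ∞ χ) (hΨ : ContMDiff (𝓡 n) 𝓘(ℝ, V) ∞ Ψ) (hχ1 : ∀ q, χ q ≤ 1)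
    (hinj : ∀ q, χ q = 1 → Function.Injective (mvfderiv (𝓡 n) Ψ q)) : SmoothMetric n N where
  inner := modifiedForm g χ Ψ
  symm q v w := by rw [modifiedForm_apply, modifiedForm_apply, g.symm, real_inner_comm]
  pos q := modifiedForm_pos g (hχ1 q) (hinj q)
  isVonNBounded q := isVonNBounded_of_pos (E := EuclideanSpace ℝ (Fin n)) _
    (modifiedForm_pos g (hχ1 q) (hinj q))
  contMDiff := by
    have h1 : ContMDiff (𝓡 n) 𝓘(ℝ) ∞ fun q => 1 - χ q := contMDiff_const.sub hχ
    exact (h1.smul_section g.contMDiff).add_section (contMDiff_inducedForm hΨ)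

end Metric

/-! ### Surfaces for a metric induced from an inner product space -/

section SecondDeriv

variable {E F V : Type*} [NormedAddCommGroup E] [NormedSpace ℝ E] [NormedAddCommGroup F]
  [NormedSpace ℝ F] [NormedAddCommGroup V] [NormedSpace ℝ V]

/-- The second derivative `∂_u ∂_v f` at `s`. -/
noncomputable def secondDeriv (f : E → F) (s u v : E) : F :=
  fderiv ℝ (fun t => fderiv ℝ f t v) s u

lemma differentiableAt_fderiv_apply {f : E → F} {s : E} (hf : ContDiffAt ℝ 2 f s) (v : E) :
    DifferentiableAt ℝ (fun t => fderiv ℝ f t v) s :=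
  ((hf.fderiv_right (m := 1) (by norm_num)).differentiableAt (by simp)).clm_apply
    (differentiableAt_const v)

lemma secondDeriv_eq {f : E → F} {s : E} (hf : ContDiffAt ℝ 2 f s) (u v : E) :
    secondDeriv f s u v = fderiv ℝ (fderiv ℝ f) s u v := by
  have h := (hf.fderiv_right (m := 1) (by norm_num)).differentiableAt (by simp)
  rw [secondDeriv, fderiv_clm_apply h (differentiableAt_const v)]
  simp

lemma secondDeriv_comm {f : E → F} {s : E} (hf : ContDiffAt ℝ 2 f s) (u v : E) :
    secondDeriv f s u v = secondDeriv f s v u := by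
  rw [secondDeriv_eq hf, secondDeriv_eq hf]
  exact (hf.isSymmSndFDerivAt (by simp)).eq u v

lemma secondDeriv_comp {f : F → V} {Y : E → F} {s : E} (hf : ContDiffAt ℝ 2 f (Y s))
    (hY : ContDiffAt ℝ 2 Y s) (u v : E) :
    secondDeriv (f ∘ Y) s u v =
      secondDeriv f (Y s) (fderiv ℝ Y s u) (fderiv ℝ Y s v) +
        fderiv ℝ f (Y s) (secondDeriv Y s u v) := by
  have h1 : (fun t => fderiv ℝ (f ∘ Y) t v) =ᶠ[𝓝 s] fun t => fderiv ℝ f (Y t) (fderiv ℝ Y t v) := by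
    filter_upwards [hY.eventually (by simp), hY.continuousAt.eventually (hf.eventually (by simp))]
      with t ht ht'
    rw [fderiv_comp t (ht'.differentiableAt (by simp)) (ht.differentiableAt (by simp))]
    rfl
  have hd := (hf.fderiv_right (m := 1) (by norm_num)).differentiableAt (by simp)
  have hYd := hY.differentiableAt (by simp)
  have hd' : DifferentiableAt ℝ (fun t => fderiv ℝ f (Y t)) s := hd.comp s hYd
  rw [secondDeriv, h1.fderiv_eq, fderiv_clm_apply hd' (differentiableAt_fderiv_apply hY v),
    secondDeriv_eq hf]
  have h2 : fderiv ℝ (fun t => fderiv ℝ f (Y t)) s =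
      fderiv ℝ (fderiv ℝ f) (Y s) ∘L fderiv ℝ Y s := fderiv_comp s hd hYd
  simp [h2, secondDeriv]
  rw [add_comm]

end SecondDeriv

section Induced

variable {n : ℕ} {N : Type*} [TopologicalSpace N]
  [ChartedSpace (EuclideanSpace ℝ (Fin n)) N] [IsManifold (𝓡 n) ∞ N]
  {V : Type*} [NormedAddCommGroup V] [InnerProductSpace ℝ V]

lemma fderiv_comp_extChartAt_symm {Ψ : N → V} (hΨ : ContMDiff (𝓡 n) 𝓘(ℝ, V) ∞ Ψ) (q : N)
    {y : EuclideanSpace ℝ (Fin n)} (hy : y ∈ (extChartAt (𝓡 n) q).target)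
    (v : EuclideanSpace ℝ (Fin n)) :
    fderiv ℝ (Ψ ∘ (extChartAt (𝓡 n) q).symm) y v =
      mvfderiv (𝓡 n) Ψ ((extChartAt (𝓡 n) q).symm y)
        (mfderiv (𝓡 n) (𝓡 n) (extChartAt (𝓡 n) q).symm y v) := by
  have hd : MDifferentiableAt (𝓡 n) (𝓡 n) (extChartAt (𝓡 n) q).symm y := by
    have := mdifferentiableWithinAt_extChartAt_symm (I := 𝓡 n) hy
    rwa [ModelWithCorners.range_eq_univ, mdifferentiableWithinAt_univ] at this
  have h := mfderiv_comp_apply y (hΨ.mdifferentiable (by simp) _) hd v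
  rw [mfderiv_eq_fderiv] at h
  exact h

lemma eventually_metricMatrix_eq (g : SmoothMetric n N) {Ψ : N → V} {q : N}
    (hΨ : ContMDiff (𝓡 n) 𝓘(ℝ, V) ∞ Ψ) (hg : ∀ᶠ r in 𝓝 q, g.inner r = inducedForm Ψ r)
    (a b : Fin n) :
    (fun y => metricMatrix g q y a b) =ᶠ[𝓝 (extChartAt (𝓡 n) q q)] fun y =>
      inner ℝ (fderiv ℝ (Ψ ∘ (extChartAt (𝓡 n) q).symm) y (EuclideanSpace.single a 1))
        (fderiv ℝ (Ψ ∘ (extChartAt (𝓡 n) q).symm) y (EuclideanSpace.single b 1)) := by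
  have h1 := continuousAt_extChartAt_symm (I := 𝓡 n) q
  rw [ContinuousAt, extChartAt_to_inv] at h1
  filter_upwards [extChartAt_target_mem_nhds (I := 𝓡 n) q, h1.eventually hg] with y hy hgy
  simp only [metricMatrix, Matrix.of_apply, hgy, inducedForm_apply,
    fderiv_comp_extChartAt_symm hΨ q hy]

omit [IsManifold (𝓡 n) ∞ N] in
lemma tangentVec_eq {X : (Fin 2 → ℝ) → N} {s : Fin 2 → ℝ}
    (hY : DifferentiableAt ℝ (extChartAt (𝓡 n) (X s) ∘ X) s) (i : Fin 2) (k : Fin n) :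
    tangentVec X s i k = fderiv ℝ (extChartAt (𝓡 n) (X s) ∘ X) s (Pi.single i 1) k := by
  have h := ((EuclideanSpace.proj (𝕜 := ℝ) k).hasFDerivAt.comp s hY.hasFDerivAt).fderiv
  exact congrArg (fun L => L (Pi.single i 1)) h

omit [IsManifold (𝓡 n) ∞ N] in
lemma secondPartial_eq {X : (Fin 2 → ℝ) → N} {s : Fin 2 → ℝ}
    (hY : ContDiffAt ℝ 2 (extChartAt (𝓡 n) (X s) ∘ X) s) (i j : Fin 2) (k : Fin n) :
    secondPartial X s i j k =
      secondDeriv (extChartAt (𝓡 n) (X s) ∘ X) s (Pi.single i 1) (Pi.single j 1) k := by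
  have h1 : (fun t => fderiv ℝ (fun r => extChartAt (𝓡 n) (X s) (X r) k) t (Pi.single j 1))
      =ᶠ[𝓝 s] fun t => (EuclideanSpace.proj (𝕜 := ℝ) k)
        (fderiv ℝ (extChartAt (𝓡 n) (X s) ∘ X) t (Pi.single j 1)) := by
    filter_upwards [hY.eventually (by simp)] with t ht
    have h := ((EuclideanSpace.proj (𝕜 := ℝ) k).hasFDerivAt.comp t
      (ht.differentiableAt (by simp)).hasFDerivAt).fderiv
    exact congrArg (fun L => L (Pi.single j 1)) h
  rw [secondPartial, h1.fderiv_eq]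
  have h := ((EuclideanSpace.proj (𝕜 := ℝ) k).hasFDerivAt.comp s
    (differentiableAt_fderiv_apply hY (Pi.single j 1)).hasFDerivAt).fderiv
  exact congrArg (fun L => L (Pi.single i 1)) h

lemma eq_sum_single (v : EuclideanSpace ℝ (Fin n)) :
    v = ∑ a, v a • EuclideanSpace.single a (1 : ℝ) := by
  ext i
  simp [Finset.sum_apply, Pi.single_apply]

/-- **Gauss formula.** For the metric induced by a map `Ψ` to an inner product space, a surface `X`
has vanishing covariant derivatives `∇_{∂_i} ∂_j X` as soon as the second derivatives of `Ψ ∘ X` are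
orthogonal to the image of the differential of `Ψ`. -/
lemma covDeriv_eq_zero (g : SmoothMetric n N) {Ψ : N → V} {X : (Fin 2 → ℝ) → N} {s : Fin 2 → ℝ}
    (hΨ : ContMDiff (𝓡 n) 𝓘(ℝ, V) ∞ Ψ) (hX : ContMDiff 𝓘(ℝ, Fin 2 → ℝ) (𝓡 n) ∞ X)
    (hg : ∀ᶠ r in 𝓝 (X s), g.inner r = inducedForm Ψ r)
    (hinj : Function.Injective (mvfderiv (𝓡 n) Ψ (X s))) (i j : Fin 2)
    (horth : ∀ v, inner ℝ (secondDeriv (Ψ ∘ X) s (Pi.single i 1) (Pi.single j 1))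
      (mvfderiv (𝓡 n) Ψ (X s) v) = 0) :
    covDeriv g X s i j = 0 := by
  set κ := extChartAt (𝓡 n) (X s) with hκ
  set f : EuclideanSpace ℝ (Fin n) → V := Ψ ∘ κ.symm with hf
  set Y : (Fin 2 → ℝ) → EuclideanSpace ℝ (Fin n) := κ ∘ X with hYdef
  have hfs : ContDiffAt ℝ ∞ f (Y s) := by
    rw [← contMDiffAt_iff_contDiffAt]
    exact hΨ.contMDiffAt.comp _ ((contMDiffOn_extChartAt_symm (X s)).contMDiffAt
      (extChartAt_target_mem_nhds (X s)))
  have hf2 : ContDiffAt ℝ 2 f (Y s) := hfs.of_le ENat.LEInfty.out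
  have hYs : ContDiffAt ℝ ∞ Y s := by
    rw [← contMDiffAt_iff_contDiffAt]
    exact contMDiffAt_extChartAt.comp s hX.contMDiffAt
  have hY2 : ContDiffAt ℝ 2 Y s := hYs.of_le ENat.LEInfty.out
  have hfY : f ∘ Y =ᶠ[𝓝 s] Ψ ∘ X := by
    filter_upwards [hX.continuous.continuousAt.eventually
      (extChartAt_source_mem_nhds (I := 𝓡 n) (X s))] with t ht
    simp only [hf, hYdef, Function.comp]
    rw [hκ, (extChartAt (𝓡 n) (X s)).left_inv ht]
  have hYt : Y s ∈ κ.target := mem_extChartAt_target (X s)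
  obtain ⟨hinj', horth'⟩ : Function.Injective (mvfderiv (𝓡 n) Ψ (κ.symm (Y s))) ∧
      ∀ v, inner ℝ (secondDeriv (Ψ ∘ X) s (Pi.single i 1) (Pi.single j 1))
        (mvfderiv (𝓡 n) Ψ (κ.symm (Y s)) v) = 0 := by
    have hr : κ.symm (Y s) = X s := extChartAt_to_inv (X s)
    generalize κ.symm (Y s) = r at hr
    subst hr
    exact ⟨hinj, horth⟩
  have hfL : ∀ v, fderiv ℝ f (Y s) v = mvfderiv (𝓡 n) Ψ (κ.symm (Y s))
      (mfderiv (𝓡 n) (𝓡 n) κ.symm (Y s) v) := fderiv_comp_extChartAt_symm hΨ (X s) hYt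
  have hL : Function.Injective (mfderiv (𝓡 n) (𝓡 n) κ.symm (Y s)) := by
    have := isInvertible_mfderivWithin_extChartAt_symm (I := 𝓡 n) hYt
    rw [ModelWithCorners.range_eq_univ, mfderivWithin_univ] at this
    exact this.injective
  let e : Fin n → EuclideanSpace ℝ (Fin n) := fun a => EuclideanSpace.single a (1 : ℝ)
  let d : Fin n → V := fun a => fderiv ℝ f (Y s) (e a)
  set M := metricMatrix g (X s) (Y s) with hM
  have hMab : ∀ a b, M a b = inner ℝ (d a) (d b) := fun a b =>
    (eventually_metricMatrix_eq g hΨ hg a b).self_of_nhds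
  have hdet : IsUnit M.det := by
    have : M = Matrix.gram ℝ d := by
      ext a b
      rw [hMab, Matrix.gram_apply]
    rw [isUnit_iff_ne_zero, this, Matrix.det_gram_ne_zero_iff_linearIndependent]
    have he : LinearIndependent ℝ e := by
      have h := (EuclideanSpace.basisFun (Fin n) ℝ).toBasis.linearIndependent
      have he' : ⇑(EuclideanSpace.basisFun (Fin n) ℝ).toBasis = e := by
        funext a
        simp [e]
      rwa [he'] at h
    refine he.map' (fderiv ℝ f (Y s) : EuclideanSpace ℝ (Fin n) →ₗ[ℝ] V)
      (LinearMap.ker_eq_bot.2 fun v w h => hL (hinj' ?_))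
    exact (hfL v).symm.trans (h.trans (hfL w))
  have hP : ∀ c a b, metricPartial g (X s) c a b =
      inner ℝ (d a) (secondDeriv f (Y s) (e c) (e b)) +
        inner ℝ (secondDeriv f (Y s) (e c) (e a)) (d b) := by
    intro c a b
    rw [metricPartial, (eventually_metricMatrix_eq g hΨ hg a b).fderiv_eq]
    exact fderiv_inner_apply ℝ (differentiableAt_fderiv_apply hf2 (e a))
      (differentiableAt_fderiv_apply hf2 (e b)) (e c)
  -- For an induced metric, the Christoffel symbols with lowered index are `⟨∂_a ∂_b f, ∂_l f⟩`.
  have hΓ : ∀ k a b, christoffel g (X s) k a b =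
      ∑ l, M⁻¹ k l * inner ℝ (secondDeriv f (Y s) (e a) (e b)) (d l) := by
    intro k a b
    rw [christoffel, Finset.mul_sum]
    refine Finset.sum_congr rfl fun l _ => ?_
    rw [hP, hP, hP, secondDeriv_comm hf2 (e l) (e a), secondDeriv_comm hf2 (e l) (e b),
      secondDeriv_comm hf2 (e b) (e a), real_inner_comm (d l) (secondDeriv f (Y s) (e a) (e b)),
      real_inner_comm (d b)]
    change _ * (M⁻¹ k l * _) = _
    ring
  set u := fderiv ℝ Y s (Pi.single i 1) with hu
  set w := fderiv ℝ Y s (Pi.single j 1) with hw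
  set h := secondDeriv Y s (Pi.single i 1) (Pi.single j 1) with hh
  -- The second derivative of `Ψ ∘ X`, paired with the coordinate fields.
  have hkey : ∀ l, ∑ a, ∑ b, inner ℝ (secondDeriv f (Y s) (e a) (e b)) (d l) * u a * w b +
      ∑ m, M l m * h m = 0 := by
    intro l
    have h1 := horth' (mfderiv (𝓡 n) (𝓡 n) κ.symm (Y s) (e l))
    rw [← hfL] at h1
    have h2 : secondDeriv (Ψ ∘ X) s (Pi.single i 1) (Pi.single j 1) =
        secondDeriv (f ∘ Y) s (Pi.single i 1) (Pi.single j 1) := by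
      have : (fun t => fderiv ℝ (Ψ ∘ X) t (Pi.single j 1)) =ᶠ[𝓝 s]
          fun t => fderiv ℝ (f ∘ Y) t (Pi.single j 1) := by
        filter_upwards [hfY.symm.fderiv (𝕜 := ℝ)] with t ht
        rw [ht]
      rw [secondDeriv, secondDeriv, this.fderiv_eq]
    rw [h2, secondDeriv_comp hf2 hY2, inner_add_left] at h1
    rw [← h1]
    congr 1
    · rw [secondDeriv_eq hf2]
      conv_rhs => rw [← hu, ← hw, eq_sum_single u, eq_sum_single w]
      simp only [map_sum, map_smul, sum_apply, smul_apply, sum_inner,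
        inner_smul_left, Finset.mul_sum, secondDeriv_eq hf2]
      rw [Finset.sum_comm]
      refine Finset.sum_congr rfl fun b _ => Finset.sum_congr rfl fun a _ => ?_
      simp only [conj_trivial, d, e]
      ring
    · conv_rhs => rw [← hh, eq_sum_single h]
      simp only [map_sum, map_smul, sum_inner, inner_smul_left, hMab]
      refine Finset.sum_congr rfl fun m _ => ?_
      rw [real_inner_comm]
      simp [d, e, mul_comm]
  funext k
  have h1 : (h k : ℝ) = ∑ l, M⁻¹ k l * ∑ m, M l m * h m := by
    have : (M⁻¹).mulVec (M.mulVec h) = h := by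
      rw [Matrix.mulVec_mulVec, Matrix.nonsing_inv_mul _ hdet, Matrix.one_mulVec]
    exact (congrFun this k).symm
  rw [covDeriv, secondPartial_eq hY2]
  simp only [hΓ, tangentVec_eq (hY2.differentiableAt (by simp))]
  change h k + ∑ a, ∑ b, (∑ l, M⁻¹ k l * inner ℝ (secondDeriv f (Y s) (e a) (e b)) (d l)) *
    u a * w b = 0
  have h2 : ∑ a, ∑ b, (∑ l, M⁻¹ k l * inner ℝ (secondDeriv f (Y s) (e a) (e b)) (d l)) *
      u a * w b = ∑ l, M⁻¹ k l *
        ∑ a, ∑ b, inner ℝ (secondDeriv f (Y s) (e a) (e b)) (d l) * u a * w b := by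
    simp only [Finset.sum_mul, Finset.mul_sum]
    rw [Finset.sum_comm_cycle]
    simp only [mul_assoc]
  rw [h1, h2, ← Finset.sum_add_distrib]
  refine Finset.sum_eq_zero fun l _ => ?_
  rw [← mul_add, add_comm, hkey, mul_zero]

end Induced

/-! ### Comparison of Riemannian distances and completeness -/

section Complete

variable {n : ℕ} {N : Type*} [TopologicalSpace N]
  [ChartedSpace (EuclideanSpace ℝ (Fin n)) N] [IsManifold (𝓡 n) ∞ N]

/-- A Riemannian metric is locally comparable to the model norm in a trivialization. -/
lemma exists_comparison_trivialization (g : SmoothMetric n N) (x : N) :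
    ∃ C : ℝ, 0 < C ∧ ∀ᶠ q in 𝓝 x, ∀ v : TangentSpace (𝓡 n) q,
      g.inner q v v ≤ C * ‖(trivializationAt (EuclideanSpace ℝ (Fin n))
        (fun q : N => TangentSpace (𝓡 n) q) x).continuousLinearMapAt ℝ q v‖ ^ 2 ∧
      ‖(trivializationAt (EuclideanSpace ℝ (Fin n))
        (fun q : N => TangentSpace (𝓡 n) q) x).continuousLinearMapAt ℝ q v‖ ^ 2 ≤
        C * g.inner q v v := by
  let : RiemannianBundle (fun q : N => TangentSpace (𝓡 n) q) := ⟨g.toRiemannianMetric⟩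
  have : IsContinuousRiemannianBundle (EuclideanSpace ℝ (Fin n))
      (fun q : N => TangentSpace (𝓡 n) q) :=
    ⟨⟨g.inner, g.contMDiff.continuous, fun _ _ _ => rfl⟩⟩
  have hn : ∀ (q : N) (v : TangentSpace (𝓡 n) q), g.inner q v v = ‖v‖ ^ 2 := fun q v =>
    real_inner_self_eq_norm_sq v
  obtain ⟨C₁, hC₁, h₁⟩ := eventually_norm_trivializationAt_lt (EuclideanSpace ℝ (Fin n))
    (fun q : N => TangentSpace (𝓡 n) q) x
  obtain ⟨C₂, hC₂, h₂⟩ := eventually_norm_symmL_trivializationAt_lt (EuclideanSpace ℝ (Fin n))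
    (fun q : N => TangentSpace (𝓡 n) q) x
  refine ⟨C₁ ^ 2 + C₂ ^ 2, by positivity, ?_⟩
  filter_upwards [h₁, h₂, (trivializationAt (EuclideanSpace ℝ (Fin n))
    (fun q : N => TangentSpace (𝓡 n) q) x).open_baseSet.mem_nhds
      (FiberBundle.mem_baseSet_trivializationAt' x)] with q h₁ h₂ hq v
  set T := (trivializationAt (EuclideanSpace ℝ (Fin n))
    (fun q : N => TangentSpace (𝓡 n) q) x).continuousLinearMapAt ℝ q
  set S := (trivializationAt (EuclideanSpace ℝ (Fin n))
    (fun q : N => TangentSpace (𝓡 n) q) x).symmL ℝ q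
  have hST : S (T v) = v := Trivialization.symmL_continuousLinearMapAt _ hq v
  have e₁ : ‖T v‖ ≤ C₁ * ‖v‖ := (T.le_opNorm v).trans (by gcongr)
  have e₂ : ‖v‖ ≤ C₂ * ‖T v‖ := by
    conv_lhs => rw [← hST]
    exact (S.le_opNorm _).trans (by gcongr)
  rw [hn]
  have e₃ := pow_le_pow_left₀ (norm_nonneg _) e₁ 2
  have e₄ := pow_le_pow_left₀ (norm_nonneg _) e₂ 2
  rw [mul_pow] at e₃ e₄
  constructor
  · nlinarith [mul_nonneg (sq_nonneg C₁) (sq_nonneg ‖T v‖)]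
  · nlinarith [mul_nonneg (sq_nonneg C₂) (sq_nonneg ‖v‖)]

/-- Two Riemannian metrics that agree off a compact set are uniformly comparable. -/
lemma exists_comparison (g g' : SmoothMetric n N) {K : Set N} (hK : IsCompact K)
    (h : ∀ q ∉ K, g.inner q = g'.inner q) :
    ∃ C : ℝ, 0 < C ∧ ∀ q, ∀ v : TangentSpace (𝓡 n) q, g.inner q v v ≤ C * g'.inner q v v := by
  have hnn : ∀ (g : SmoothMetric n N) q (v : TangentSpace (𝓡 n) q), 0 ≤ g.inner q v v := by
    intro g q v
    rcases eq_or_ne v 0 with rfl | hv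
    · simp
    · exact (g.pos q v hv).le
  have hloc : ∃ C : ℝ, 0 < C ∧ ∀ q ∈ K, ∀ v : TangentSpace (𝓡 n) q,
      g.inner q v v ≤ C * g'.inner q v v := by
    refine hK.induction_on (p := fun K => ∃ C : ℝ, 0 < C ∧ ∀ q ∈ K,
      ∀ v : TangentSpace (𝓡 n) q, g.inner q v v ≤ C * g'.inner q v v)
      ⟨1, one_pos, by simp⟩ ?_ ?_ ?_
    · rintro s t hst ⟨C, hC, h⟩
      exact ⟨C, hC, fun q hq => h q (hst hq)⟩
    · rintro s t ⟨C, hC, h⟩ ⟨D, hD, h'⟩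
      refine ⟨C + D, by positivity, fun q hq v => ?_⟩
      have h0 := hnn g' q v
      rcases hq with hq | hq
      · nlinarith [h q hq v]
      · nlinarith [h' q hq v]
    · intro x _
      obtain ⟨C, hC, h₁⟩ := exists_comparison_trivialization g x
      obtain ⟨D, hD, h₂⟩ := exists_comparison_trivialization g' x
      refine ⟨_, mem_nhdsWithin_of_mem_nhds (h₁.and h₂), C * D, by positivity, ?_⟩
      rintro q ⟨h₁, h₂⟩ v
      calc g.inner q v v ≤ C * _ := (h₁ v).1
        _ ≤ C * (D * g'.inner q v v) := by gcongr; exact (h₂ v).2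
        _ = C * D * g'.inner q v v := by ring
  obtain ⟨C, hC, hCK⟩ := hloc
  refine ⟨C + 1, by positivity, fun q v => ?_⟩
  have h0 := hnn g' q v
  by_cases hq : q ∈ K
  · nlinarith [hCK q hq v]
  · rw [h q hq]
    nlinarith

/-- The `g`-length of the path `γ : [0, 1] → N`. -/
noncomputable def pathLength (g : SmoothMetric n N) (γ : ℝ → N) : ℝ≥0∞ :=
  ∫⁻ t in Icc 0 1, ENNReal.ofReal √(g.inner (γ t) (mfderiv 𝓘(ℝ) (𝓡 n) γ t (1 : ℝ))
    (mfderiv 𝓘(ℝ) (𝓡 n) γ t (1 : ℝ)))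

lemma gdist_le_pathLength (g : SmoothMetric n N) {γ : ℝ → N}
    (hγ : ContMDiffOn 𝓘(ℝ) (𝓡 n) 1 γ (Icc 0 1)) : gdist g (γ 0) (γ 1) ≤ pathLength g γ := by
  let : RiemannianBundle (fun q : N => TangentSpace (𝓡 n) q) := ⟨g.toRiemannianMetric⟩
  refine (riemannianEDist_le_pathELength hγ rfl rfl zero_le_one).trans_eq ?_
  rw [pathELength_eq_lintegral_mfderiv_Icc, pathLength]
  refine lintegral_congr fun t => ?_
  rw [← ofReal_norm, norm_eq_sqrt_real_inner]
  rfl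

lemma exists_pathLength_lt (g : SmoothMetric n N) {p q : N} {r : ℝ≥0∞} (h : gdist g p q < r) :
    ∃ γ : ℝ → N, γ 0 = p ∧ γ 1 = q ∧ ContMDiffOn 𝓘(ℝ) (𝓡 n) 1 γ (Icc 0 1) ∧
      pathLength g γ < r := by
  let : RiemannianBundle (fun q : N => TangentSpace (𝓡 n) q) := ⟨g.toRiemannianMetric⟩
  obtain ⟨γ, h0, h1, hγ, hr⟩ := exists_lt_of_riemannianEDist_lt (I := 𝓡 n) h
  refine ⟨γ, h0, h1, hγ, lt_of_eq_of_lt ?_ hr⟩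
  rw [pathELength_eq_lintegral_mfderiv_Icc, pathLength]
  refine lintegral_congr fun t => ?_
  rw [← ofReal_norm, norm_eq_sqrt_real_inner]
  rfl

lemma gdist_le_mul (g g' : SmoothMetric n N) {C : ℝ} (hC : 0 < C)
    (h : ∀ q, ∀ v : TangentSpace (𝓡 n) q, g.inner q v v ≤ C * g'.inner q v v) (p q : N) :
    gdist g p q ≤ ENNReal.ofReal √C * gdist g' p q := by
  have h0 : ENNReal.ofReal √C ≠ 0 := by simpa using hC
  rw [mul_comm, ← ENNReal.div_le_iff h0 ENNReal.ofReal_ne_top]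
  refine le_of_forall_gt fun r hr => ?_
  obtain ⟨γ, rfl, rfl, hγ, hl⟩ := exists_pathLength_lt g' hr
  refine lt_of_le_of_lt ?_ hl
  rw [ENNReal.div_le_iff h0 ENNReal.ofReal_ne_top, mul_comm]
  refine (gdist_le_pathLength g hγ).trans ?_
  rw [pathLength, pathLength, ← lintegral_const_mul' _ _ ENNReal.ofReal_ne_top]
  refine lintegral_mono fun t => ?_
  rw [← ENNReal.ofReal_mul (Real.sqrt_nonneg _), ← Real.sqrt_mul hC.le]
  exact ENNReal.ofReal_le_ofReal (Real.sqrt_le_sqrt (h _ _))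

/-- Completeness is not affected by changing the metric on a compact set. -/
lemma IsCompleteMetric.of_eq_off_compact {g g' : SmoothMetric n N} (hg : IsCompleteMetric g)
    {K : Set N} (hK : IsCompact K) (h : ∀ q ∉ K, g'.inner q = g.inner q) :
    IsCompleteMetric g' := by
  obtain ⟨C, hC, hgC⟩ := exists_comparison g g' hK fun q hq => (h q hq).symm
  obtain ⟨D, hD, hgD⟩ := exists_comparison g' g hK h
  intro u hu
  obtain ⟨a, ha⟩ := hg u fun δ hδ => by
    have h0 : ENNReal.ofReal √C ≠ 0 := by simpa using hC
    obtain ⟨k, hk⟩ := hu (δ / ENNReal.ofReal √C) (ENNReal.div_pos hδ.ne' ENNReal.ofReal_ne_top)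
    refine ⟨k, fun i hi j hj => (gdist_le_mul g g' hC hgC _ _).trans_lt ?_⟩
    have := hk i hi j hj
    rwa [ENNReal.lt_div_iff_mul_lt (Or.inl h0) (Or.inl ENNReal.ofReal_ne_top), mul_comm] at this
  refine ⟨a, ?_⟩
  have h2 : Tendsto (fun i => ENNReal.ofReal √D * gdist g (u i) a) atTop (𝓝 0) := by
    simpa using ENNReal.Tendsto.const_mul ha (Or.inr ENNReal.ofReal_ne_top)
  exact tendsto_of_tendsto_of_tendsto_of_le_of_le tendsto_const_nhds h2 (fun _ => zero_le)
    fun i => gdist_le_mul g' g hD hgD _ _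

lemma geodesicBall_mem_nhds (g : SmoothMetric n N) (p : N) {ε : ℝ} (hε : 0 < ε) :
    geodesicBall g p ε ∈ 𝓝 p := by
  let : RiemannianBundle (fun q : N => TangentSpace (𝓡 n) q) := ⟨g.toRiemannianMetric⟩
  have : IsContinuousRiemannianBundle (EuclideanSpace ℝ (Fin n))
      (fun q : N => TangentSpace (𝓡 n) q) :=
    ⟨⟨g.inner, g.contMDiff.continuous, fun _ _ _ => rfl⟩⟩
  exact eventually_riemannianEDist_lt (𝓡 n) p (ENNReal.ofReal_pos.2 hε)

end Complete

/-! ### The flat torus -/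

lemma circles_exp (s : Fin 2 → ℝ) :
    circles (Circle.exp (s 0), Circle.exp (s 1)) =
      Real.cos (s 0) • EuclideanSpace.single 0 1 + Real.sin (s 0) • EuclideanSpace.single 1 1 +
        Real.cos (s 1) • EuclideanSpace.single 2 1 + Real.sin (s 1) • EuclideanSpace.single 3 1 +
        EuclideanSpace.single 4 1 := by
  ext i
  fin_cases i <;> simp [circles, Complex.exp_re, Complex.exp_im]

lemma secondDeriv_circles_exp (s u v : Fin 2 → ℝ) :
    secondDeriv (fun s : Fin 2 → ℝ => circles (Circle.exp (s 0), Circle.exp (s 1))) s u v =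
      -(u 0 * v 0) • (Real.cos (s 0) • EuclideanSpace.single 0 1 +
        Real.sin (s 0) • EuclideanSpace.single 1 1) -
      (u 1 * v 1) • (Real.cos (s 1) • EuclideanSpace.single 2 1 +
        Real.sin (s 1) • EuclideanSpace.single 3 1) := by
  have hp : ∀ (i : Fin 2) (t : Fin 2 → ℝ), HasFDerivAt (fun t : Fin 2 → ℝ => t i)
      (ContinuousLinearMap.proj (R := ℝ) (φ := fun _ : Fin 2 => ℝ) i) t :=
    fun i t => hasFDerivAt_apply i t
  have h1 : (fun t => fderiv ℝ (fun s : Fin 2 → ℝ =>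
      circles (Circle.exp (s 0), Circle.exp (s 1))) t v) = fun t =>
        (-Real.sin (t 0) * v 0) • EuclideanSpace.single 0 1 +
        (Real.cos (t 0) * v 0) • EuclideanSpace.single 1 1 +
        (-Real.sin (t 1) * v 1) • EuclideanSpace.single 2 1 +
        (Real.cos (t 1) * v 1) • EuclideanSpace.single 3 1 := by
    funext t
    simp only [circles_exp]
    have h := (((((hp 0 t).cos.smul_const (EuclideanSpace.single (0 : Fin 5) (1 : ℝ))).add
      ((hp 0 t).sin.smul_const (EuclideanSpace.single (1 : Fin 5) (1 : ℝ)))).add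
      ((hp 1 t).cos.smul_const (EuclideanSpace.single (2 : Fin 5) (1 : ℝ)))).add
      ((hp 1 t).sin.smul_const (EuclideanSpace.single (3 : Fin 5) (1 : ℝ)))).add_const
      (EuclideanSpace.single (4 : Fin 5) (1 : ℝ))
    refine (congrArg (fun L => L v) h.fderiv).trans ?_
    simp
  rw [secondDeriv, h1]
  have h := ((((((hp 0 s).sin.neg.mul_const (v 0)).smul_const
      (EuclideanSpace.single (0 : Fin 5) (1 : ℝ))).add
      (((hp 0 s).cos.mul_const (v 0)).smul_const (EuclideanSpace.single (1 : Fin 5) (1 : ℝ)))).add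
      (((hp 1 s).sin.neg.mul_const (v 1)).smul_const
      (EuclideanSpace.single (2 : Fin 5) (1 : ℝ)))).add
      (((hp 1 s).cos.mul_const (v 1)).smul_const (EuclideanSpace.single (3 : Fin 5) (1 : ℝ))))
  refine (congrArg (fun L => L u) h.fderiv).trans ?_
  ext i
  fin_cases i <;> simp <;> ring

section

variable {n : ℕ} {N : Type*} [TopologicalSpace N]
  [ChartedSpace (EuclideanSpace ℝ (Fin n)) N]

/-- The differential of a map to `S¹ × S¹ × ℝ` is orthogonal to both radial directions. -/
lemma mvfderiv_bicircle {Ψ : N → EuclideanSpace ℝ (Fin 5)} {q : N}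
    (hΨ : MDifferentiableAt (𝓡 n) 𝓘(ℝ, EuclideanSpace ℝ (Fin 5)) Ψ q)
    (h : ∀ᶠ r in 𝓝 q, Ψ r ∈ bicircle) (v : TangentSpace (𝓡 n) q) :
    Ψ q 0 * mvfderiv (𝓡 n) Ψ q v 0 + Ψ q 1 * mvfderiv (𝓡 n) Ψ q v 1 = 0 ∧
      Ψ q 2 * mvfderiv (𝓡 n) Ψ q v 2 + Ψ q 3 * mvfderiv (𝓡 n) Ψ q v 3 = 0 := by
  have key : ∀ i j : Fin 5, (∀ᶠ r in 𝓝 q, Ψ r i ^ 2 + Ψ r j ^ 2 = 1) →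
      Ψ q i * mvfderiv (𝓡 n) Ψ q v i + Ψ q j * mvfderiv (𝓡 n) Ψ q v j = 0 := by
    intro i j hij
    have hp : ∀ i : Fin 5, HasFDerivAt (fun w : EuclideanSpace ℝ (Fin 5) => w i)
        (EuclideanSpace.proj (𝕜 := ℝ) i) (Ψ q) := fun i =>
      (EuclideanSpace.proj (𝕜 := ℝ) i).hasFDerivAt
    have h1 := (((hp i).pow 2).add ((hp j).pow 2)).hasMFDerivAt.comp q hΨ.hasMFDerivAt
    have h2 : HasMFDerivAt (𝓡 n) 𝓘(ℝ, ℝ) (fun _ : N => (1 : ℝ)) q _ :=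
      h1.congr_of_eventuallyEq (hij.mono fun r hr => hr.symm)
    have h3 := congrArg (fun L => L v) (hasMFDerivAt_unique h2 (hasMFDerivAt_const (1 : ℝ) q))
    have h4 : 2 * Ψ q i * mvfderiv (𝓡 n) Ψ q v i + 2 * Ψ q j * mvfderiv (𝓡 n) Ψ q v j = 0 := by
      refine Eq.trans ?_ h3
      change _ = ((2 • Ψ q i ^ (2 - 1)) • EuclideanSpace.proj (𝕜 := ℝ) i +
        (2 • Ψ q j ^ (2 - 1)) • EuclideanSpace.proj (𝕜 := ℝ) j :
          EuclideanSpace ℝ (Fin 5) →L[ℝ] ℝ) (mvfderiv (𝓡 n) Ψ q v)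
      simp
    linarith
  exact ⟨key 0 1 (h.mono fun r hr => hr.1), key 2 3 (h.mono fun r hr => hr.2)⟩

lemma willmoreDensity_eq_zero [IsManifold (𝓡 n) ∞ N] (g : SmoothMetric n N)
    {X : (Fin 2 → ℝ) → N} {s : Fin 2 → ℝ} (h : ∀ i j, covDeriv g X s i j = 0) :
    willmoreDensity g X s = 0 := by
  have h1 : ∀ i j, secondForm g X s i j = 0 := fun i j => by
    simp [secondForm, normalPart, h, ginner]
  simp [willmoreDensity, secondFormNormSq, meanCurvature, h1, ginner]

end

end Willmore

theorem proposition3p6 {N : Type*} [TopologicalSpace N] [T2Space N]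
    [ChartedSpace (EuclideanSpace ℝ (Fin 3)) N] [IsManifold (𝓡 3) ∞ N]
    (g : Willmore.SmoothMetric 3 N) (hg : Willmore.IsCompleteMetric g)
    (p : N) (ε : ℝ) (hε : 0 < ε) :
    ∃ g' : Willmore.SmoothMetric 3 N,
      Willmore.IsCompleteMetric g' ∧
      (∀ q : N, q ∉ Willmore.geodesicBall g p ε → g'.inner q = g.inner q) ∧
      ∃ x : Circle × Circle → N,
        Willmore.IsImmersedTorus 3 x ∧
        IntegrableOn (Willmore.willmoreDensity g' (Willmore.angular x)) Willmore.angleSquare ∧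
        Willmore.willmore g' x = 0 := by
  open Willmore in
  obtain ⟨K, χ, Ψ, x, hK, hKU, hχ, hΨ, hχ1, hoff, hinj, hx, hΨx, hnear⟩ :=
    exists_local_torus p (geodesicBall_mem_nhds g p hε)
  -- Near the torus `χ = 1`, so `g` does not enter `g'` there.
  let g' := modifiedMetric g χ Ψ hχ hΨ (fun q => (hχ1 q).2) hinj
  have hg'off : ∀ q ∉ K, g'.inner q = g.inner q := by
    intro q hq
    obtain ⟨h0, h1⟩ := hoff q hq
    have h2 : mvfderiv (𝓡 3) Ψ q = 0 := by
      have := (hasMFDerivAt_const (I := 𝓡 3) (I' := 𝓘(ℝ, EuclideanSpace ℝ (Fin 5)))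
        (0 : EuclideanSpace ℝ (Fin 5)) q).congr_of_eventuallyEq h1
      rw [mvfderiv, this.mfderiv]
      rfl
    ext v w
    change modifiedForm g χ Ψ q v w = _
    simp [modifiedForm_apply, h0, h2]
  have hg'near : ∀ z, ∀ᶠ q in 𝓝 (x z), g'.inner q = inducedForm Ψ q := by
    intro z
    filter_upwards [hnear z] with q hq
    ext v w
    change modifiedForm g χ Ψ q v w = _
    simp [modifiedForm_apply, inducedForm_apply, hq.1]
  -- The covariant derivatives vanish, not merely their normal parts: the torus is flat and the
  -- angular coordinates are affine.
  have hdens : willmoreDensity g' (angular x) = 0 := by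
    funext s
    refine willmoreDensity_eq_zero g' fun i j => ?_
    have hX : ContMDiff 𝓘(ℝ, Fin 2 → ℝ) (𝓡 3) ∞ (angular x) := by
      have hp : ∀ i : Fin 2, ContMDiff 𝓘(ℝ, Fin 2 → ℝ) 𝓘(ℝ) ∞ fun s : Fin 2 → ℝ => s i :=
        fun i => (contDiff_apply ℝ ℝ i).contMDiff
      exact hx.comp ((contMDiff_circleExp.comp (hp 0)).prodMk (contMDiff_circleExp.comp (hp 1)))
    refine covDeriv_eq_zero g' hΨ hX (hg'near _) (hinj _ (hnear _).self_of_nhds.1) i j fun v => ?_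
    have h1 : Ψ ∘ angular x = fun s => circles (Circle.exp (s 0), Circle.exp (s 1)) :=
      funext fun s => hΨx _
    obtain ⟨h2, h3⟩ := mvfderiv_bicircle (hΨ.mdifferentiable (by simp) _)
      ((hnear (Circle.exp (s 0), Circle.exp (s 1))).mono fun q hq => hq.2) v
    rw [hΨx, circles_exp] at h2 h3
    simp at h2 h3
    rw [h1, secondDeriv_circles_exp]
    simp only [inner_sub_left, inner_smul_left, inner_add_left, EuclideanSpace.inner_single_left]
    have h2' : Real.cos (s 0) * mvfderiv (𝓡 3) Ψ (angular x s) v 0 +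
        Real.sin (s 0) * mvfderiv (𝓡 3) Ψ (angular x s) v 1 = 0 := h2
    have h3' : Real.cos (s 1) * mvfderiv (𝓡 3) Ψ (angular x s) v 2 +
        Real.sin (s 1) * mvfderiv (𝓡 3) Ψ (angular x s) v 3 = 0 := h3
    simp [h2', h3']
  refine ⟨g', hg.of_eq_off_compact hK hg'off, fun q hq => hg'off q fun h => hq (hKU h), x,
    ⟨hx, fun z => ?_⟩, ?_, ?_⟩
  · have h1 := (hΨ.mdifferentiable (by simp) (x z)).hasMFDerivAt.comp z
      (hx.mdifferentiable (by simp) z).hasMFDerivAt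
    have h2 : Ψ ∘ x = circles := funext hΨx
    rw [h2] at h1
    have h3 := mfderiv_circles_injective z
    rw [h1.mfderiv] at h3
    exact Function.Injective.of_comp (f := mfderiv (𝓡 3) 𝓘(ℝ, EuclideanSpace ℝ (Fin 5)) Ψ (x z)) h3
  · rw [hdens]
    exact integrableOn_zero
  · rw [willmore, hdens]
    simp
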